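/- A continuous function $f:\mathbb R\to\mathbb C$ is called relatively operator Lipschitz if there is $k>0$ such that $$\|f(B)-f(A)\|\le k\,\|(B-A)(A+iI)^{-1}\|$$ for all (not necessarily bounded) self-adjoint operators $A$ and $B=A+K$ on a complex Hilbert space, where $K$ is a relatively bounded self-adjoint perturbation of $A$, i.e. a self-adjoint operator with $\operatorname{Dom}(A)\subset\operatorname{Dom}(K)$ (and $(B-A)(A+iI)^{-1}$ is the bounded operator $K(A+iI)^{-1}$). Theorem 2.4. For a function $f:\mathbb R\to\mathbb C$ consider the conditions (a) there is a constant $C$ such that $|f(s)-f(t)|\le C\,|s-t|\,(1+|t|)^{-1}$ for all $s,t\in\mathbb R$; (b) there is a constant $C$ such that $|f(s)-f(t)|\le C\,\dfrac{|s-t|}{1+|s|+|t|}$ for all $s,t\in\mathbb R$; (c) the function $s\mapsto (s+i)f(s)$ is a Lipschitz function on $\mathbb R$. Conditions (a), (b) and (c) are equivalent, and every relatively operator Lipschitz function $f$ satisfies them. -/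

import Mathlib

open MeasureTheory Complex
open scoped InnerProductSpace ENNReal NNReal

universe u

/-- A spectral measure on the Borel sets of `ℝ` acting on the Hilbert space `H`: an assignment of
orthogonal projections to Borel sets, equal to the identity on `ℝ` and countably additive in the
strong operator topology. (Multiplicativity `E (s ∩ t) = E s * E t` follows from these. The values
on non-measurable sets play no role.) -/
structure BorelSpectralMeasure (H : Type*) [NormedAddCommGroup H] [InnerProductSpace ℂ H]
    [CompleteSpace H] where
  /-- The projection attached to a set. -/
  proj : Set ℝ → H →L[ℂ] H
  isStarProjection : ∀ s, MeasurableSet s → IsStarProjection (proj s)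
  proj_univ : proj Set.univ = 1
  hasSum_iUnion : ∀ s : ℕ → Set ℝ, (∀ n, MeasurableSet (s n)) →
    Pairwise (fun m n => Disjoint (s m) (s n)) →
    ∀ v : H, HasSum (fun n => proj (s n) v) (proj (⋃ n, s n) v)

namespace BorelSpectralMeasure

variable {H : Type*} [NormedAddCommGroup H] [InnerProductSpace ℂ H] [CompleteSpace H]

theorem inner_proj_eq (E : BorelSpectralMeasure H) (v : H) {s : Set ℝ} (hs : MeasurableSet s) :
    (⟪v, E.proj s v⟫_ℂ).re = ‖E.proj s v‖ ^ 2 := by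
  obtain ⟨hi, ha⟩ := E.isStarProjection s hs
  have h1 : E.proj s (E.proj s v) = E.proj s v := by
    have := congrArg (fun T : H →L[ℂ] H => T v) hi.eq
    simpa using this
  have h2 : ⟪v, E.proj s v⟫_ℂ = ⟪E.proj s v, E.proj s v⟫_ℂ := by
    conv_lhs => rw [← h1]
    exact (ha.isSymmetric v (E.proj s v)).symm
  rw [h2, inner_self_eq_norm_sq_to_K]
  norm_cast

theorem proj_empty_apply (E : BorelSpectralMeasure H) (v : H) : E.proj ∅ v = 0 := by
  have h := E.hasSum_iUnion (fun _ => ∅) (fun _ => MeasurableSet.empty)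
    (fun _ _ _ => disjoint_bot_left) v
  exact tendsto_nhds_unique tendsto_const_nhds h.summable.tendsto_atTop_zero

/-- The scalar measure `s ↦ ⟪v, E s v⟫ = ‖E s v‖ ^ 2` on the Borel sets of `ℝ`. -/
noncomputable def measure (E : BorelSpectralMeasure H) (v : H) : Measure ℝ :=
  Measure.ofMeasurable (fun s _ => ENNReal.ofReal (⟪v, E.proj s v⟫_ℂ).re)
    (by simp [proj_empty_apply])
    (by
      intro s hs hd
      have h := E.hasSum_iUnion s hs hd v
      have h2 : HasSum (fun n => (⟪v, E.proj (s n) v⟫_ℂ).re)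
          (⟪v, E.proj (⋃ n, s n) v⟫_ℂ).re := by
        have h3 := h.mapL (innerSL ℂ v)
        exact Complex.hasSum_re (by simpa using h3)
      have h0 : ∀ n, 0 ≤ (⟪v, E.proj (s n) v⟫_ℂ).re := fun n => by
        rw [E.inner_proj_eq v (hs n)]; positivity
      rw [← h2.tsum_eq, ENNReal.ofReal_tsum_of_nonneg h0 h2.summable])

theorem measure_apply (E : BorelSpectralMeasure H) (v : H) {s : Set ℝ} (hs : MeasurableSet s) :
    E.measure v s = ENNReal.ofReal (⟪v, E.proj s v⟫_ℂ).re :=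
  Measure.ofMeasurable_apply s hs

/-- `E.IsIntegral f T` says that `T` is the (possibly unbounded) operator `∫ f dE`: its domain is
`{v | ∫ |f x|² d⟪v, E x v⟫ < ∞}` and `⟪v, T v⟫ = ∫ f x d⟪v, E x v⟫` on it. By polarization these
conditions determine `T`, as the domain is dense. -/
def IsIntegral (E : BorelSpectralMeasure H) (f : ℝ → ℂ) (T : H →ₗ.[ℂ] H) : Prop :=
  (∀ v : H, v ∈ T.domain ↔ MemLp f 2 (E.measure v)) ∧
    ∀ v : T.domain, ⟪(v : H), T v⟫_ℂ = ∫ x, f x ∂(E.measure (v : H))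

end BorelSpectralMeasure

/-- `T = f(A)`: for the spectral measure `E` of `A`, that is, for `E` with `A = ∫ x dE`, one has
`T = ∫ f dE`. For self-adjoint `A` such an `E` exists and is unique by the spectral theorem. -/
def IsFunctionOf {H : Type*} [NormedAddCommGroup H] [InnerProductSpace ℂ H] [CompleteSpace H]
    (f : ℝ → ℂ) (A T : H →ₗ.[ℂ] H) : Prop :=
  ∃ E : BorelSpectralMeasure H, E.IsIntegral (fun x : ℝ => (x : ℂ)) A ∧ E.IsIntegral f T

/-- `K` is a relatively bounded self-adjoint perturbation of `A`. -/
structure IsRelativelyBoundedPerturbation {H : Type*} [NormedAddCommGroup H]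
    [InnerProductSpace ℂ H] [CompleteSpace H] (A K : H →ₗ.[ℂ] H) : Prop where
  isSelfAdjoint : IsSelfAdjoint K
  domain_le : A.domain ≤ K.domain

/-- `C` is the bounded operator `K (A + i I)⁻¹`, that is, `C (A + i I) = K` on the domain of `A`.
If `A` is self-adjoint then `A + i I` maps the domain of `A` bijectively onto `H`, so there is at
most one such `C`; it exists when `K` is a relatively bounded perturbation of `A`. -/
def IsMulResolvent {H : Type*} [NormedAddCommGroup H] [InnerProductSpace ℂ H]
    (A K : H →ₗ.[ℂ] H) (C : H →L[ℂ] H) : Prop :=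
  ∀ v : H, ∀ hA : v ∈ A.domain, ∀ hK : v ∈ K.domain, C (A ⟨v, hA⟩ + I • v) = K ⟨v, hK⟩

/-- Relatively operator Lipschitz functions: `f` is continuous and there is `k > 0` such that
`‖f(B) - f(A)‖ ≤ k ‖K (A + i I)⁻¹‖` for all self-adjoint `A` and `B = A + K`, with `K` a relatively
bounded self-adjoint perturbation of `A`, in arbitrary complex Hilbert spaces.
The operator difference is bounded on its natural domain `Dom f(B) ∩ Dom f(A)`. -/
def RelativelyOperatorLipschitz (f : ℝ → ℂ) : Prop :=
  Continuous f ∧ ∃ k : ℝ, 0 < k ∧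
    ∀ (H : Type u) [NormedAddCommGroup H] [InnerProductSpace ℂ H] [CompleteSpace H]
      (A B K : H →ₗ.[ℂ] H), IsSelfAdjoint A → IsSelfAdjoint B →
      IsRelativelyBoundedPerturbation A K → B = A + K →
      ∀ (fA fB : H →ₗ.[ℂ] H) (C : H →L[ℂ] H), IsFunctionOf f A fA → IsFunctionOf f B fB →
      IsMulResolvent A K C → ∀ v : (fB - fA).domain, ‖(fB - fA) v‖ ≤ k * ‖C‖ * ‖(v : H)‖

/-! Necessity needs only scalar operators. On a one-dimensional space take `A = t`, `B = s`: then
`f(B) - f(A)` is `f s - f t` and `K (A + iI)⁻¹` is `(s - t) / (t + i)`, so the operator estimate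
becomes (a), because `|t + i|` and `1 + |t|` are comparable. The work is in realising scalars as
unbounded operators with a spectral measure. The equivalence is elementary: (a) symmetrises to (b),
and the product rule for differences of `(s + i) f s`, together with boundedness of `f`, links (b)
and (a) with (c). -/

section ScalarOperator

variable (H : Type*) [NormedAddCommGroup H] [InnerProductSpace ℂ H]

/-- Multiplication by the scalar `c`, as an everywhere defined operator. -/
noncomputable def scalarPMap (c : ℂ) : H →ₗ.[ℂ] H :=
  ((c • (1 : H →L[ℂ] H) : H →L[ℂ] H) : H →ₗ[ℂ] H).toPMap ⊤

@[simp]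
theorem scalarPMap_domain (c : ℂ) : (scalarPMap H c).domain = ⊤ := rfl

@[simp]
theorem scalarPMap_apply (c : ℂ) (v : (scalarPMap H c).domain) :
    scalarPMap H c v = c • (v : H) := rfl

theorem scalarPMap_add (c d : ℂ) : scalarPMap H (c + d) = scalarPMap H c + scalarPMap H d := by
  refine LinearPMap.ext (by simp [LinearPMap.add_domain]) fun v hv hv' => ?_
  rw [LinearPMap.add_apply]
  exact add_smul c d v

variable [CompleteSpace H]

theorem isSelfAdjoint_scalarPMap (t : ℝ) : IsSelfAdjoint (scalarPMap H t) := by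
  rw [LinearPMap.isSelfAdjoint_def, scalarPMap,
    ContinuousLinearMap.toPMap_adjoint_eq_adjoint_toPMap_of_dense _ (by simp)]
  congr 2
  rw [← ContinuousLinearMap.star_eq_adjoint]
  simp

open Classical in
/-- The spectral measure of the operator `t • 1`: the point mass at `t`. -/
noncomputable def diracSpectralMeasure (t : ℝ) : BorelSpectralMeasure H where
  proj s := if t ∈ s then 1 else 0
  isStarProjection s _ := by
    split_ifs
    · exact IsStarProjection.one _
    · exact IsStarProjection.zero _
  proj_univ := by simp
  hasSum_iUnion s _ hd v := by
    by_cases h : ∃ n, t ∈ s n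
    · obtain ⟨n, hn⟩ := h
      have hU : t ∈ ⋃ n, s n := Set.mem_iUnion.2 ⟨n, hn⟩
      have := hasSum_single (f := fun m => (if t ∈ s m then (1 : H →L[ℂ] H) else 0) v) n
        fun m hm => by
          rw [if_neg fun h => Set.disjoint_left.1 (hd hm) h hn]
          rfl
      simpa only [if_pos hn, if_pos hU] using this
    · have hU : t ∉ ⋃ n, s n := by simpa using h
      simp only [not_exists] at h
      simp [h, hU]

theorem diracSpectralMeasure_measure (t : ℝ) (v : H) :
    (diracSpectralMeasure H t).measure v = ENNReal.ofReal (‖v‖ ^ 2) • Measure.dirac t := by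
  ext s hs
  rw [BorelSpectralMeasure.measure_apply _ _ hs, BorelSpectralMeasure.inner_proj_eq _ _ hs,
    Measure.smul_apply, Measure.dirac_apply' _ hs]
  by_cases h : t ∈ s <;> simp [diracSpectralMeasure, h]

/-- Against a point mass every function is a.e. constant, so no regularity of `f` is needed. The
case of the identity function recovers `t • 1` itself. -/
theorem diracSpectralMeasure_isIntegral (f : ℝ → ℂ) (t : ℝ) :
    (diracSpectralMeasure H t).IsIntegral f (scalarPMap H (f t)) := by
  refine ⟨fun v => iff_of_true trivial ?_, fun v => ?_⟩
  · rw [diracSpectralMeasure_measure]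
    refine MemLp.smul_measure ?_ ENNReal.ofReal_ne_top
    exact (memLp_congr_ae (ae_eq_dirac f)).2 (memLp_const _)
  · rw [diracSpectralMeasure_measure, integral_smul_measure, integral_dirac, scalarPMap_apply,
      inner_smul_right, inner_self_eq_norm_sq_to_K, ENNReal.toReal_ofReal (by positivity)]
    simp [mul_comm]

theorem isFunctionOf_scalarPMap (f : ℝ → ℂ) (t : ℝ) :
    IsFunctionOf f (scalarPMap H t) (scalarPMap H (f t)) :=
  ⟨diracSpectralMeasure H t, diracSpectralMeasure_isIntegral H (fun x => (x : ℂ)) t,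
    diracSpectralMeasure_isIntegral H f t⟩

end ScalarOperator

theorem ofReal_add_I_ne_zero (t : ℝ) : (t : ℂ) + I ≠ 0 := fun h => by
  simpa using congrArg Complex.im h

theorem norm_ofReal_add_I_le (t : ℝ) : ‖(t : ℂ) + I‖ ≤ 1 + |t| := by
  calc ‖(t : ℂ) + I‖ ≤ ‖(t : ℂ)‖ + ‖I‖ := norm_add_le _ _
    _ = 1 + |t| := by simp [add_comm]

theorem one_add_abs_le_two_mul_norm (t : ℝ) : 1 + |t| ≤ 2 * ‖(t : ℂ) + I‖ := by
  have h1 := Complex.abs_re_le_norm ((t : ℂ) + I)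
  have h2 := Complex.abs_im_le_norm ((t : ℂ) + I)
  simp at h1 h2
  linarith

/-- Testing on the scalar operators `t • 1` and `s • 1`. -/
theorem RelativelyOperatorLipschitz.exists_norm_sub_le {f : ℝ → ℂ}
    (hf : RelativelyOperatorLipschitz.{u} f) :
    ∃ c : ℝ, ∀ s t : ℝ, ‖f s - f t‖ ≤ c * |s - t| * (1 + |t|)⁻¹ := by
  obtain ⟨-, k, hk, h⟩ := hf
  refine ⟨2 * k, fun s t => ?_⟩
  -- `PUnit.{u + 1}` lies in `Type u`, so this is a copy of `ℂ` in the universe over which the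
  -- hypothesis quantifies.
  let H := EuclideanSpace ℂ PUnit.{u + 1}
  let q : ℂ := ((s - t : ℝ) : ℂ) / ((t : ℂ) + I)
  let C : H →L[ℂ] H := q • 1
  have hB : scalarPMap H s = scalarPMap H t + scalarPMap H ((s - t : ℝ) : ℂ) := by
    rw [← scalarPMap_add]
    simp
  have hC : IsMulResolvent (scalarPMap H t) (scalarPMap H ((s - t : ℝ) : ℂ)) C := by
    intro v _ _
    simp only [scalarPMap_apply, ← add_smul, C, smul_apply,
      one_apply_eq_self, smul_smul, q]
    rw [div_mul_cancel₀ _ (ofReal_add_I_ne_zero t)]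
  obtain ⟨v, hv⟩ := exists_ne (0 : H)
  have key := h H _ _ _ (isSelfAdjoint_scalarPMap H t) (isSelfAdjoint_scalarPMap H s)
    ⟨isSelfAdjoint_scalarPMap H (s - t), le_rfl⟩ hB _ _ C (isFunctionOf_scalarPMap H f t)
    (isFunctionOf_scalarPMap H f s) hC ⟨v, by simp [LinearPMap.sub_domain]⟩
  rw [LinearPMap.sub_apply] at key
  simp only [scalarPMap_apply, ← sub_smul, norm_smul] at key
  have hCn : ‖C‖ = |s - t| / ‖(t : ℂ) + I‖ := by
    simp only [C, q, norm_smul, norm_one, mul_one, norm_div, Complex.norm_real, Real.norm_eq_abs]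
  have hle := le_of_mul_le_mul_right key (norm_pos_iff.2 hv)
  have hpos : 0 < ‖(t : ℂ) + I‖ := norm_pos_iff.2 (ofReal_add_I_ne_zero t)
  rw [hCn] at hle
  refine hle.trans ?_
  rw [← div_eq_mul_inv, mul_div_assoc', div_le_div_iff₀ hpos (by positivity)]
  have := mul_le_mul_of_nonneg_left (one_add_abs_le_two_mul_norm t)
    (mul_nonneg hk.le (abs_nonneg (s - t)))
  linarith

theorem tfae_relative_lipschitz (f : ℝ → ℂ) :
    List.TFAE
      [∃ c : ℝ, ∀ s t : ℝ, ‖f s - f t‖ ≤ c * |s - t| * (1 + |t|)⁻¹,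
       ∃ c : ℝ, ∀ s t : ℝ, ‖f s - f t‖ ≤ c * (|s - t| / (1 + |s| + |t|)),
       ∃ c : ℝ≥0, LipschitzWith c (fun s : ℝ => ((s : ℂ) + I) * f s)] := by
  tfae_have 1 → 2 := by
    rintro ⟨c, h⟩
    refine ⟨2 * c, fun s t => ?_⟩
    -- Adding (a) to itself with `s` and `t` swapped gives the weight `2 + |s| + |t|`, which
    -- dominates `1 + |s| + |t|`.
    have h1 := h s t
    have h2 := h t s
    rw [norm_sub_rev, abs_sub_comm] at h2
    rw [← div_eq_mul_inv, le_div_iff₀ (by positivity)] at h1 h2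
    rw [mul_div_assoc', le_div_iff₀ (by positivity)]
    have := norm_nonneg (f s - f t)
    linarith
  tfae_have 2 → 3 := by
    rintro ⟨c, h⟩
    have hc (s t : ℝ) : ‖f s - f t‖ ≤ |c| * (|s - t| / (1 + |s| + |t|)) :=
      (h s t).trans (mul_le_mul_of_nonneg_right (le_abs_self c) (by positivity))
    -- Comparison with the value at `0` shows that `f` is bounded.
    have hb (s : ℝ) : ‖f s‖ ≤ |c| + ‖f 0‖ := by
      have h0 := hc s 0
      have h1 : |s - 0| / (1 + |s| + |0|) ≤ 1 := by
        rw [div_le_one (by positivity)]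
        simp
      have h2 := mul_le_mul_of_nonneg_left h1 (abs_nonneg c)
      have h3 := norm_sub_norm_le (f s) (f 0)
      linarith
    refine ⟨NNReal.mk (|c| + ‖f 0‖ + |c|) (by positivity), LipschitzWith.of_dist_le_mul fun s t => ?_⟩
    rw [dist_eq_norm, Real.dist_eq, NNReal.coe_mk]
    have e : ((s : ℂ) + I) * f s - ((t : ℂ) + I) * f t
        = ((s - t : ℝ) : ℂ) * f s + ((t : ℂ) + I) * (f s - f t) := by
      push_cast
      ring
    rw [e, add_mul (|c| + ‖f 0‖)]
    refine (norm_add_le _ _).trans (add_le_add ?_ ?_)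
    · rw [norm_mul, Complex.norm_real, Real.norm_eq_abs, mul_comm]
      exact mul_le_mul_of_nonneg_right (hb s) (abs_nonneg _)
    · rw [norm_mul]
      calc ‖(t : ℂ) + I‖ * ‖f s - f t‖
          ≤ (1 + |s| + |t|) * (|c| * (|s - t| / (1 + |s| + |t|))) := by
            refine mul_le_mul ?_ (hc s t) (norm_nonneg _) (by positivity)
            linarith [norm_ofReal_add_I_le t, abs_nonneg s]
        _ = |c| * |s - t| := by field_simp
  tfae_have 3 → 1 := by
    rintro ⟨c, h⟩
    have hg (s t : ℝ) : ‖((s : ℂ) + I) * f s - ((t : ℂ) + I) * f t‖ ≤ c * |s - t| := by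
      simpa [dist_eq_norm] using h.dist_le_mul s t
    have hpos (t : ℝ) : 0 < ‖(t : ℂ) + I‖ := norm_pos_iff.2 (ofReal_add_I_ne_zero t)
    -- Again `f` is bounded: `|s + i| ‖f s‖ ≤ c |s| + ‖f 0‖`, and both `|s|` and `1` are at most `|s
    -- + i|`.
    have hb (s : ℝ) : ‖f s‖ ≤ c + ‖f 0‖ := by
      have h0 := hg s 0
      have h1 := norm_sub_norm_le (((s : ℂ) + I) * f s) (((0 : ℝ) + I) * f 0)
      have h2 : |s| ≤ ‖(s : ℂ) + I‖ := by simpa using Complex.abs_re_le_norm ((s : ℂ) + I)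
      have h3 : 1 ≤ ‖(s : ℂ) + I‖ := by simpa using Complex.abs_im_le_norm ((s : ℂ) + I)
      have h4 := mul_le_mul_of_nonneg_left h2 c.coe_nonneg
      have h5 := mul_le_mul_of_nonneg_right h3 (norm_nonneg (f 0))
      have h6 : ‖(((0 : ℝ) : ℂ) + I) * f 0‖ = ‖f 0‖ := by simp
      rw [norm_mul] at h1
      rw [h6] at h1
      rw [sub_zero] at h0
      refine le_of_mul_le_mul_left ?_ (hpos s)
      linarith
    -- One `c` is the Lipschitz constant, `c + ‖f 0‖` bounds `f`, and the factor 2 comes from `1 +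
    -- |t| ≤ 2 |t + i|`.
    refine ⟨2 * (c + (c + ‖f 0‖)), fun s t => ?_⟩
    have e : ((t : ℂ) + I) * (f s - f t)
        = (((s : ℂ) + I) * f s - ((t : ℂ) + I) * f t) - ((s - t : ℝ) : ℂ) * f s := by
      push_cast
      ring
    have h1 : ‖(t : ℂ) + I‖ * ‖f s - f t‖ ≤ (c + (c + ‖f 0‖)) * |s - t| := by
      rw [← norm_mul, e, add_mul (c : ℝ)]
      refine (norm_sub_le _ _).trans (add_le_add (hg s t) ?_)
      rw [norm_mul, Complex.norm_real, Real.norm_eq_abs, mul_comm]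
      exact mul_le_mul_of_nonneg_right (hb s) (abs_nonneg _)
    rw [← div_eq_mul_inv, le_div_iff₀ (by positivity)]
    have := mul_le_mul_of_nonneg_right (one_add_abs_le_two_mul_norm t) (norm_nonneg (f s - f t))
    linarith
  tfae_finish

theorem theorem2p4 (f : ℝ → ℂ) :
    (RelativelyOperatorLipschitz.{u} f →
      (∃ c : ℝ, ∀ s t : ℝ, ‖f s - f t‖ ≤ c * |s - t| * (1 + |t|)⁻¹) ∧
      (∃ c : ℝ, ∀ s t : ℝ, ‖f s - f t‖ ≤ c * (|s - t| / (1 + |s| + |t|))) ∧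
      (∃ c : ℝ≥0, LipschitzWith c (fun s : ℝ => ((s : ℂ) + I) * f s))) ∧
    List.TFAE
      [∃ c : ℝ, ∀ s t : ℝ, ‖f s - f t‖ ≤ c * |s - t| * (1 + |t|)⁻¹,
       ∃ c : ℝ, ∀ s t : ℝ, ‖f s - f t‖ ≤ c * (|s - t| / (1 + |s| + |t|)),
       ∃ c : ℝ≥0, LipschitzWith c (fun s : ℝ => ((s : ℂ) + I) * f s)] := by
  have tfae := tfae_relative_lipschitz f
  refine ⟨fun hf => ?_, tfae⟩
  have ha := hf.exists_norm_sub_le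
  exact ⟨ha, (tfae.out 0 1).1 ha, (tfae.out 0 2).1 ha⟩
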